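/- Let $\Gamma_0(2)=\{\left(\begin{smallmatrix}a&b\\c&d\end{smallmatrix}\right)\in\mathrm{SL}_2(\mathbb Z): c\equiv 0 \pmod 2\}$, $W_2=\left(\begin{smallmatrix}0&-1/\sqrt2\\ \sqrt2&0\end{smallmatrix}\right)$, and let $\Gamma_0^*(2)=\Gamma_0(2)\cup\Gamma_0(2)W_2$ be the Fricke group. For an integer $k$ let $M_{k,2}$ be the space of (holomorphic) modular forms of weight $k$ for $\Gamma_0^*(2)$. For even $k\ge 4$ and $z$ in the upper half plane $\mathbb H$ put $$E_k(z)=\frac12\sum_{\gcd(c,d)=1}(cz+d)^{-k},\qquad E^*_{k,2}(z)=\frac{1}{2^{k/2}+1}\left(2^{k/2}E_k(2z)+E_k(z)\right)\in M_{k,2}.$$ For $p\in\mathbb H$ let $v_p(f)$ be the order of vanishing at $z=p$ of the holomorphic function $f(z)$ on $\mathbb H$ (with $v_p(0)=\infty$), and let $\rho_2=e^{3\pi i/4}/\sqrt2$. Proposition. Let $k\ge4$ be an even integer. Let $s_k\in\{0,1\}$ be such that $2s_k\equiv k\pmod 4$, and let $t_k\in\{0,1,2,3\}$ be such that $-2t_k\equiv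 k\pmod 8$. Then for every $f\in M_{k,2}$, $$v_{i/\sqrt2}(f)\ge s_k\qquad\text{and}\qquad v_{\rho_2}(f)\ge t_k.$$ In particular, if $f$ is a nonzero constant multiple of $E^*_{k,2}$, then both inequalities are equalities. -/

import Mathlib

open UpperHalfPlane ModularForm CongruenceSubgroup Matrix.SpecialLinearGroup
open scoped MatrixGroups ModularForm Manifold

noncomputable section

namespace Fricke

/-- `Γ₀(p)` inside `GL(2, ℝ)`. -/
abbrev Gamma0GL (p : ℕ) : Subgroup (GL (Fin 2) ℝ) := (Gamma0 p).map (mapGL ℝ)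

/-- The Fricke involution `W_p = (0, -1/√p; √p, 0)`. -/
def W (p : ℕ) [NeZero p] : GL (Fin 2) ℝ :=
  Matrix.GeneralLinearGroup.mkOfDetNeZero !![0, -1 / √(p : ℝ); √(p : ℝ), 0] (by
    have : √(p : ℝ) ≠ 0 := by simp [NeZero.ne p]
    simp [Matrix.det_fin_two, this])

lemma sqrt_ne (p : ℕ) [NeZero p] : √(p : ℝ) ≠ 0 := by simp [NeZero.ne p]

lemma W_coe (p : ℕ) [NeZero p] :
    ((W p : GL (Fin 2) ℝ) : Matrix (Fin 2) (Fin 2) ℝ) = !![0, -1 / √(p : ℝ); √(p : ℝ), 0] := rfl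

lemma W_det (p : ℕ) [NeZero p] : (W p).det = 1 := by
  have := sqrt_ne p
  ext
  simp [W_coe, Matrix.det_fin_two, this]

lemma neg_one_mem (p : ℕ) : (-1 : GL (Fin 2) ℝ) ∈ Gamma0GL p := by
  refine ⟨-1, by simp [Gamma0_mem], ?_⟩
  ext i j
  simp

lemma W_mul_W (p : ℕ) [NeZero p] : W p * W p = -1 := by
  have := sqrt_ne p
  ext i j
  fin_cases i <;> fin_cases j <;> simp [W_coe]
  · field_simp
  · field_simp

lemma W_inv (p : ℕ) [NeZero p] : (W p)⁻¹ = -1 * W p := by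
  rw [inv_eq_iff_mul_eq_one]
  simp [W_mul_W]

/-- `W_p` normalises `Γ₀(p)`. -/
lemma W_mul (p : ℕ) [NeZero p] {g : GL (Fin 2) ℝ} (hg : g ∈ Gamma0GL p) :
    ∃ h ∈ Gamma0GL p, W p * g = h * W p := by
  obtain ⟨γ, hγ, rfl⟩ := hg
  have hγ' : γ ∈ Gamma0 p := hγ
  rw [Gamma0_mem, ZMod.intCast_zmod_eq_zero_iff_dvd] at hγ'
  obtain ⟨c, hc⟩ := hγ'
  have hdet := Matrix.det_fin_two γ.1
  rw [γ.2, hc] at hdet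
  obtain ⟨δ, hδ⟩ : ∃ δ : SL(2, ℤ), δ.1 = !![γ 1 1, -c; -(p : ℤ) * γ 0 1, γ 0 0] :=
    ⟨⟨_, by rw [Matrix.det_fin_two]; simp; linarith⟩, rfl⟩
  have hδ' : δ ∈ Gamma0 p := by rw [Gamma0_mem]; simp [hδ]
  refine ⟨_, ⟨δ, hδ', rfl⟩, ?_⟩
  have h0 := sqrt_ne p
  have h1 : √(p : ℝ) * √(p : ℝ) = p := Real.mul_self_sqrt (Nat.cast_nonneg p)
  ext i j
  fin_cases i <;> fin_cases j <;>
    simp [W_coe, Matrix.mul_apply, Fin.sum_univ_two, hc, hδ]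
  · field_simp
    linear_combination (c : ℝ) * h1
  · field_simp
  · ring
  · field_simp
    linear_combination (γ 0 1 : ℝ) * h1

/-- The Fricke group `Γ₀*(p) = Γ₀(p) ∪ Γ₀(p) W_p`. -/
def Gamma0Star (p : ℕ) [NeZero p] : Subgroup (GL (Fin 2) ℝ) where
  carrier := {g | g ∈ Gamma0GL p ∨ ∃ h ∈ Gamma0GL p, g = h * W p}
  one_mem' := Or.inl (one_mem _)
  mul_mem' := by
    rintro a b (ha | ⟨a, ha, rfl⟩) (hb | ⟨b, hb, rfl⟩)
    · exact Or.inl (mul_mem ha hb)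
    · exact Or.inr ⟨a * b, mul_mem ha hb, by rw [mul_assoc]⟩
    · obtain ⟨c, hc, h⟩ := W_mul p hb
      exact Or.inr ⟨a * c, mul_mem ha hc, by rw [mul_assoc, h, mul_assoc]⟩
    · obtain ⟨c, hc, h⟩ := W_mul p hb
      refine Or.inl ?_
      have : a * W p * (b * W p) = a * c * -1 := by
        rw [← W_mul_W p, mul_assoc a, ← mul_assoc (W p), h]
        simp only [mul_assoc]
      rw [this]
      exact mul_mem (mul_mem ha hc) (neg_one_mem p)
  inv_mem' := by
    rintro a (ha | ⟨a, ha, rfl⟩)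
    · exact Or.inl (inv_mem ha)
    · obtain ⟨c, hc, h⟩ := W_mul p (inv_mem ha)
      exact Or.inr ⟨-1 * c, mul_mem (neg_one_mem p) hc, by
        rw [mul_inv_rev, W_inv, mul_assoc, h, mul_assoc]⟩

lemma W_mem (p : ℕ) [NeZero p] : W p ∈ Gamma0Star p := Or.inr ⟨1, one_mem _, by simp⟩

lemma Gamma0GL_le (p : ℕ) : Gamma0GL p ≤ 𝒮ℒ := by
  rintro _ ⟨γ, -, rfl⟩
  exact ⟨γ, rfl⟩

instance (p : ℕ) [NeZero p] : (Gamma0Star p).HasDetOne where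
  det_eq := by
    rintro g (⟨γ, -, rfl⟩ | ⟨_, ⟨γ, -, rfl⟩, rfl⟩) <;> simp [W_det]

lemma isCusp_SL2Z (p : ℕ) [NeZero p] {c : OnePoint ℝ} (hc : IsCusp c (Gamma0Star p)) :
    IsCusp c 𝒮ℒ := by
  obtain ⟨g, hg, hgp, hgc⟩ := hc
  refine ⟨g ^ 2, Gamma0GL_le p ?_, hgp.pow two_ne_zero, by rw [sq, mul_smul, hgc, hgc]⟩
  rcases hg with hg | ⟨h, hh, rfl⟩
  · exact pow_mem hg 2
  · obtain ⟨c, hc, h'⟩ := W_mul p hh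
    have : (h * W p) ^ 2 = h * c * -1 := by
      rw [sq, ← W_mul_W p, mul_assoc h, ← mul_assoc (W p), h']
      simp only [mul_assoc]
    rw [this]
    exact mul_mem (mul_mem hh hc) (neg_one_mem p)

/-- The point `p z` of the upper half plane. -/
def natSMul (p : ℕ) [NeZero p] (z : ℍ) : ℍ :=
  ⟨p * z, by
    have : (0 : ℝ) < p := Nat.cast_pos.mpr (NeZero.pos p)
    simpa using mul_pos this z.im_pos⟩

/-- `E*_{k,p}(z) = (p^{k/2} E_k(p z) + E_k(z)) / (p^{k/2} + 1)`, where `E_k` is half of the sum of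
`(c z + d)^{-k}` over the coprime pairs `(c, d)`. -/
def eisensteinStarFun (p : ℕ) [NeZero p] {k : ℕ} (hk : 3 ≤ k) (z : ℍ) : ℂ :=
  1 / ((((p : ℝ) ^ ((k : ℝ) / 2) : ℝ) : ℂ) + 1) *
    ((((p : ℝ) ^ ((k : ℝ) / 2) : ℝ) : ℂ) * E hk (natSMul p z) + E hk z)

lemma slash_W (p : ℕ) [NeZero p] {k : ℕ} (hk : 3 ≤ k) (z : ℍ) :
    ((E hk : ℍ → ℂ) ∣[(k : ℤ)] W p) z
      = (((p : ℝ) ^ ((k : ℝ) / 2) : ℝ) : ℂ) * E hk (natSMul p z) := by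
  have h0 := sqrt_ne p
  have h0' : ((√(p : ℝ) : ℝ) : ℂ) ≠ 0 := by exact_mod_cast h0
  have h1 : ((√(p : ℝ) : ℝ) : ℂ) ^ 2 = p := by
    rw [← Complex.ofReal_pow, Real.sq_sqrt (Nat.cast_nonneg p)]; simp
  have hz := z.ne_zero
  have hpow : (p : ℝ) ^ ((k : ℝ) / 2) = √(p : ℝ) ^ k := by
    rw [Real.sqrt_eq_rpow, ← Real.rpow_natCast, ← Real.rpow_mul (Nat.cast_nonneg p)]
    congr 1; ring
  have hS : (E hk : ℍ → ℂ) ∣[(k : ℤ)] ModularGroup.S = E hk :=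
    SlashInvariantFormClass.slash_action_eq (E hk) _ ⟨ModularGroup.S, rfl⟩
  have hSz := congrFun hS (natSMul p z)
  rw [SL_slash_apply] at hSz
  have hpt : W p • z = ModularGroup.S • natSMul p z := by
    have hdet : 0 < (W p).det.val := by simp [W_det]
    ext
    rw [coe_smul_of_det_pos hdet, UpperHalfPlane.modular_S_smul]
    simp [num, denom, W_coe, natSMul]
    rw [← h1]
    field_simp
  have hden : denom (ModularGroup.S : GL (Fin 2) ℝ) (natSMul p z) = p * z := by
    exact ModularGroup.denom_S _
  rw [slash_apply, hpt, ← hSz, hpow]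
  generalize E hk (ModularGroup.S • natSMul p z) = x
  erw [hden]
  rw [← h1]
  simp [σ, W_det, denom, W_coe]
  field_simp
  ring

lemma eisensteinStarFun_eq (p : ℕ) [NeZero p] {k : ℕ} (hk : 3 ≤ k) :
    eisensteinStarFun p hk = (1 / ((((p : ℝ) ^ ((k : ℝ) / 2) : ℝ) : ℂ) + 1)) •
      ((E hk : ℍ → ℂ) ∣[(k : ℤ)] W p + E hk) := by
  ext z
  simp only [eisensteinStarFun, Pi.smul_apply, Pi.add_apply, slash_W, smul_eq_mul]

lemma slash_Gamma0 (p : ℕ) {k : ℕ} (hk : 3 ≤ k) {g : GL (Fin 2) ℝ}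
    (hg : g ∈ Gamma0GL p) : (E hk : ℍ → ℂ) ∣[(k : ℤ)] g = E hk :=
  SlashInvariantFormClass.slash_action_eq (E hk) _ (Gamma0GL_le p hg)

/-- The Eisenstein series `E*_{k,p}` as a modular form of weight `k` for `Γ₀*(p)`. -/
def eisensteinStar (p : ℕ) [NeZero p] {k : ℕ} (hk : 3 ≤ k) :
    ModularForm (Gamma0Star p) (k : ℤ) where
  toFun := eisensteinStarFun p hk
  slash_action_eq' g hg := by
    have key : ∀ h ∈ Gamma0GL p,
        ((E hk : ℍ → ℂ) ∣[(k : ℤ)] W p) ∣[(k : ℤ)] h = (E hk : ℍ → ℂ) ∣[(k : ℤ)] W p := by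
      intro h hh
      obtain ⟨c, hc, h'⟩ := W_mul p hh
      rw [← SlashAction.slash_mul, h', SlashAction.slash_mul, slash_Gamma0 p hk hc]
    have hσ : ∀ x : ℂ, σ g x = x := fun x => by
      have : g.det = 1 := Subgroup.HasDetOne.det_eq hg
      simp [σ, this]
    rw [eisensteinStarFun_eq, ModularForm.smul_slash, hσ]
    congr 1
    rcases hg with hg | ⟨h, hh, rfl⟩
    · rw [SlashAction.add_slash, key g hg, slash_Gamma0 p hk hg]
    · rw [SlashAction.slash_mul, SlashAction.add_slash, key h hh, slash_Gamma0 p hk hh,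
        SlashAction.add_slash, ← SlashAction.slash_mul, W_mul_W,
        slash_Gamma0 p hk (neg_one_mem p), add_comm]
  holo' := by
    change MDiff (eisensteinStarFun p hk)
    rw [eisensteinStarFun_eq]
    have h := ModularFormClass.holo (E hk)
    exact (((MDifferentiable.slash h k (W p)).add h).const_smul _)
  bdd_at_cusps' {c} hc := by
    have h1 : c.IsBoundedAt (E hk : ℍ → ℂ) k :=
      ModularFormClass.bdd_at_cusps (E hk) (isCusp_SL2Z p hc)
    have h2 : c.IsBoundedAt ((E hk : ℍ → ℂ) ∣[(k : ℤ)] W p) k :=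
      OnePoint.IsBoundedAt.smul_iff.mp <|
        ModularFormClass.bdd_at_cusps (E hk) (isCusp_SL2Z p (hc.smul_of_mem (W_mem p)))
    have h3 := h2.add h1
    change c.IsBoundedAt (eisensteinStarFun p hk) k
    rw [eisensteinStarFun_eq]
    intro g hg
    rw [ModularForm.smul_slash]
    exact (h3 g hg).const_mul_left _

/-- The order of vanishing `v_τ(f)` (in `ℕ∞`) at `τ` of a function on the upper half plane, in the
variable `z`; here `ofComplex` identifies a neighbourhood of `τ` in `ℂ` with one in `ℍ`. -/
def ordAt (f : ℍ → ℂ) (τ : ℍ) : ℕ∞ := analyticOrderAt (fun z : ℂ => f (ofComplex z)) (τ : ℂ)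

/-- The point `i / √2`. -/
def iDivSqrtTwo : ℍ := ⟨Complex.I / ((√2 : ℝ) : ℂ), by
  rw [Complex.div_ofReal_im]; simp⟩

/-- The point `ρ₂ = e^{3πi/4} / √2`. -/
def rhoTwo : ℍ := ⟨Complex.exp (Complex.I * (3 * Real.pi / 4)) / ((√2 : ℝ) : ℂ), by
  have h : Complex.I * (3 * Real.pi / 4) = ((3 * Real.pi / 4 : ℝ) : ℂ) * Complex.I := by
    push_cast; ring
  rw [Complex.div_ofReal_im, h, Complex.exp_ofReal_mul_I_im]
  have : 0 < Real.sin (3 * Real.pi / 4) :=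
    Real.sin_pos_of_pos_of_lt_pi (by positivity) (by linarith [Real.pi_pos])
  positivity⟩

end Fricke

end

namespace Fricke
open Filter Topology EisensteinSeries ComplexConjugate

/-! Both points are elliptic: `i/√2` is fixed by `z ↦ -1/(2z)`, `ρ₂` by `z ↦ -1 - 1/(2z)`. Comparing
leading Taylor terms on both sides of the transformation law at such a `τ` gives `(√2 τ)^(k+2n) =
1`, with `n` the order of vanishing (`automorphy_pow_eq_one`). As `√2 τ` is a primitive 4th, resp.
8th, root of unity, `n ≡ s` mod 2, resp. `n ≡ t` mod 4, whence the lower bounds.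

For equality, `E_k` is expanded in the Cayley coordinate `u` at `τ` (`hasSum_E_cayley`). With `L =
cτ + d`, the `n`-th coefficient is a positive multiple of the sum of `L^(-k-n) conj(L)^n` over
coprime pairs. Since `z ↦ 2z` preserves `u`, the `n`-th coefficient of the Fricke series combines
these sums at `2τ` and `τ`. For `n = s` or `t`, modularity makes the two contributions equal,
leaving a nonzero multiple of the sum at `√2 i` or `i`. There the pairs `(0, ±1)`, `(±1, 0)`
outweigh all the others (`tsum_coprime_ne_zero`). -/

/-! ### Local power series and orders of vanishing -/

/-- Write `f = (z - τ)^n h₁` with `h₁ τ ≠ 0`, divide the functional equation by `(z - τ)^n`, and let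
`z → τ`: the quotient `(g z - τ)/(z - τ)` is the slope of `g`. -/
lemma deriv_pow_eq_of_comp_eq_mul {f g J : ℂ → ℂ} {τ l : ℂ} {n : ℕ} (hf : AnalyticAt ℂ f τ)
    (hg : HasDerivAt g l τ) (hgτ : g τ = τ) (hJ : ContinuousAt J τ)
    (h : ∀ᶠ z in 𝓝 τ, f (g z) = J z * f z) (hn : analyticOrderAt f τ = n) : l ^ n = J τ := by
  obtain ⟨h₁, han, h0, heq⟩ := hf.analyticOrderAt_eq_natCast.mp hn
  have hgt : Tendsto g (𝓝 τ) (𝓝 τ) := by simpa [ContinuousAt, hgτ] using hg.continuousAt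
  have hslope := (hasDerivAt_iff_tendsto_slope.mp hg).pow n
  have hl : Tendsto (fun z => slope g τ z ^ n * h₁ (g z)) (𝓝[≠] τ) (𝓝 (l ^ n * h₁ τ)) :=
    hslope.mul ((han.continuousAt.tendsto.comp hgt).mono_left nhdsWithin_le_nhds)
  have hr : Tendsto (fun z => J z * h₁ z) (𝓝[≠] τ) (𝓝 (J τ * h₁ τ)) :=
    (hJ.tendsto.mul han.continuousAt.tendsto).mono_left nhdsWithin_le_nhds
  have key : (fun z => slope g τ z ^ n * h₁ (g z)) =ᶠ[𝓝[≠] τ] fun z => J z * h₁ z := by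
    filter_upwards [h.filter_mono nhdsWithin_le_nhds, heq.filter_mono nhdsWithin_le_nhds,
      (hgt.eventually heq).filter_mono nhdsWithin_le_nhds, self_mem_nhdsWithin] with z h1 h2 h3 h4
    have hz : z - τ ≠ 0 := sub_ne_zero.mpr h4
    rw [h3, h2] at h1
    simp only [smul_eq_mul] at h1
    rw [slope_def_field, hgτ, div_pow, div_mul_eq_mul_div, h1]
    field_simp
  exact mul_right_cancel₀ h0 (tendsto_nhds_unique_of_eventuallyEq hl hr key)

lemma coeff_eq_zero_of_lt_analyticOrderAt {f : ℂ → ℂ} {c : ℕ → ℂ} {m : ℕ}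
    (h : ∀ᶠ u in 𝓝 (0 : ℂ), HasSum (fun n => c n * u ^ n) (f u))
    (hm : (m : ℕ∞) < analyticOrderAt f 0) : c m = 0 := by
  have hp : HasFPowerSeriesAt f (FormalMultilinearSeries.ofScalars ℂ c) 0 := by
    rw [hasFPowerSeriesAt_iff]
    filter_upwards [h] with u hu
    simpa [FormalMultilinearSeries.coeff_ofScalars, mul_comm] using hu
  have hq := hp.analyticAt.hasFPowerSeriesAt
  have heq := congrArg (fun p => p.coeff m) (hp.eq_formalMultilinearSeries hq)
  have h0 := (natCast_le_analyticOrderAt_iff_iteratedDeriv_eq_zero hp.analyticAt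
    (n := m + 1)).mp (by exact_mod_cast Order.add_one_le_of_lt hm) m (Nat.lt_succ_self m)
  simpa [FormalMultilinearSeries.coeff_ofScalars, h0] using heq

/-- Expand each term by the negative binomial series in `(B/A) u`. Since `|B/A| = 1`, the double
series is dominated by a product of two convergent series, so the summations may be exchanged. -/
lemma hasSum_tsum_inv_sub_mul_pow {ι : Type*} {A B : ι → ℂ} {k : ℕ} (hA : ∀ i, A i ≠ 0)
    (hB : ∀ i, ‖B i‖ = ‖A i‖) (hs : Summable fun i => ‖(A i ^ (k + 1))⁻¹‖) {u : ℂ}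
    (hu : ‖u‖ < 1) :
    HasSum (fun n : ℕ => ((n + k).choose k * ∑' i, (A i ^ (k + 1 + n))⁻¹ * B i ^ n) * u ^ n)
      (∑' i, ((A i - B i * u) ^ (k + 1))⁻¹) := by
  set F : ι × ℕ → ℂ := fun p =>
    (A p.1 ^ (k + 1))⁻¹ * (((p.2 + k).choose k : ℂ) * (B p.1 / A p.1 * u) ^ p.2) with hF
  have hq : ∀ i, ‖B i / A i * u‖ = ‖u‖ := fun i => by
    rw [norm_mul, norm_div, hB, div_self (norm_ne_zero_iff.mpr (hA i)), one_mul]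
  have hu' : ‖(‖u‖ : ℝ)‖ < 1 := by simpa using hu
  have hsumF : Summable F := by
    refine Summable.of_norm ?_
    have := hs.mul_of_nonneg (summable_choose_mul_geometric_of_norm_lt_one k hu')
      (fun i => norm_nonneg _) (fun n => by positivity)
    refine this.congr fun p => ?_
    simp only [hF]
    rw [norm_mul, norm_mul, norm_pow, hq, Complex.norm_natCast]
  have h1 : ∀ i, HasSum (fun n => F (i, n)) ((A i - B i * u) ^ (k + 1))⁻¹ := fun i => by
    have := (hasSum_choose_mul_geometric_of_norm_lt_one k (hq i ▸ hu)).mul_left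
      (A i ^ (k + 1))⁻¹
    convert! this using 1
    rw [one_div, ← mul_inv, ← mul_pow, mul_sub, mul_one, ← mul_assoc, mul_div_cancel₀ _ (hA i)]
  have h2 := (hsumF.hasSum.prod_fiberwise h1).tsum_eq
  have h3 := hsumF.prod_symm
  have h4 := h3.hasSum.prod_fiberwise fun n => (h3.prod_factor n).hasSum
  rw [h2, ← (Equiv.prodComm ι ℕ).symm.tsum_eq]
  convert! h4 using 2 with n
  rw [mul_right_comm, ← tsum_mul_left]
  refine tsum_congr fun i => ?_
  have := hA i
  simp only [hF, Prod.swap_prod_mk]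
  rw [mul_pow, div_pow, pow_add (A i)]
  field_simp

/-! ### Lower bounds from the automorphy factor at elliptic points -/

lemma eventually_im_pos (τ : ℍ) : ∀ᶠ z : ℂ in 𝓝 (τ : ℂ), 0 < z.im :=
  (isOpen_lt continuous_const Complex.continuous_im).mem_nhds τ.im_pos

lemma analyticAt_comp_ofComplex {f : ℍ → ℂ} (hf : MDiff f) (τ : ℍ) :
    AnalyticAt ℂ (fun z : ℂ => f (ofComplex z)) τ := by
  refine (Complex.analyticAt_iff_eventually_differentiableAt).mpr ?_
  filter_upwards [eventually_im_pos τ] with z hz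
  exact mdifferentiableAt_iff.mp (hf ⟨z, hz⟩)

lemma coe_W_smul (p : ℕ) [NeZero p] (z : ℍ) : ((W p • z : ℍ) : ℂ) = -1 / (p * z) := by
  have h0' : ((√(p : ℝ) : ℝ) : ℂ) ≠ 0 := by exact_mod_cast sqrt_ne p
  have h1 : ((√(p : ℝ) : ℝ) : ℂ) ^ 2 = p := by
    rw [← Complex.ofReal_pow, Real.sq_sqrt (Nat.cast_nonneg p)]; simp
  have hz := z.ne_zero
  rw [coe_smul_of_det_pos (by simp [W_det]), ← h1]
  simp [num, denom, W_coe]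
  field_simp

lemma apply_W_smul {p : ℕ} [NeZero p] {k : ℕ} (f : ModularForm (Gamma0Star p) (k : ℤ)) (z : ℍ) :
    f (W p • z) = (((√(p : ℝ) : ℝ) : ℂ) * z) ^ k * f z := by
  have h0 : ((√(p : ℝ) : ℝ) : ℂ) ≠ 0 := by exact_mod_cast sqrt_ne p
  have hz := z.ne_zero
  have h := congrFun (SlashInvariantFormClass.slash_action_eq f _ (W_mem p)) z
  rw [slash_apply] at h
  simp [σ, W_det, denom, W_coe] at h
  rw [← h]
  field_simp

lemma apply_vadd {p : ℕ} [NeZero p] {k : ℕ} (f : ModularForm (Gamma0Star p) (k : ℤ)) (z : ℍ) :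
    f ((-1 : ℝ) +ᵥ z) = f z := by
  have hmem : (mapGL ℝ ModularGroup.T : GL (Fin 2) ℝ) ∈ Gamma0Star p :=
    Or.inl ⟨ModularGroup.T, Gamma0_mem.mpr (by simp [ModularGroup.coe_T]), rfl⟩
  set w : ℍ := (-1 : ℝ) +ᵥ z with hw
  have h : ((f : ℍ → ℂ) ∣[(k : ℤ)] ModularGroup.T) w = f w :=
    congrFun (SlashInvariantFormClass.slash_action_eq f _ hmem) w
  have h2 : ModularGroup.T • w = z := by
    rw [modular_T_smul, hw, vadd_vadd, add_neg_cancel, zero_vadd]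
  have h3 : denom (ModularGroup.T : GL (Fin 2) ℝ) w = 1 := by
    simp [denom, ModularGroup.coe_T]
  rw [← h, SL_slash_apply, h2, h3, one_zpow, mul_one]

/-- At a fixed point `τ` of `z ↦ -1 / (p z) - b`, the weight and the order of vanishing of a form
are tied together by the automorphy factor. -/
lemma automorphy_pow_eq_one {p k n : ℕ} [NeZero p] (f : ModularForm (Gamma0Star p) (k : ℤ)) {τ : ℍ}
    {b : ℝ} (hb : ∀ z : ℍ, f (b +ᵥ z) = f z) (hτ : (b : ℂ) + -1 / (p * (τ : ℂ)) = τ)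
    (hn : ordAt f τ = n) : (((√(p : ℝ) : ℝ) : ℂ) * τ) ^ (k + 2 * n) = 1 := by
  have h0 : ((√(p : ℝ) : ℝ) : ℂ) ≠ 0 := by exact_mod_cast sqrt_ne p
  have h1 : ((√(p : ℝ) : ℝ) : ℂ) ^ 2 = p := by
    rw [← Complex.ofReal_pow, Real.sq_sqrt (Nat.cast_nonneg p)]; simp
  have hz := τ.ne_zero
  have hp : (p : ℂ) ≠ 0 := by exact_mod_cast NeZero.ne p
  -- The multiplier `1/(pτ²)` is the inverse square of the base `√p τ` of the automorphy factor, so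
  -- the two combine into a single power.
  have hg : HasDerivAt (fun z : ℂ => b + -1 / (p * z)) (((((√(p : ℝ) : ℝ) : ℂ) * τ) ^ 2)⁻¹) τ := by
    have := (((hasDerivAt_id (τ : ℂ)).const_mul (p : ℂ)).fun_inv (mul_ne_zero hp hz)).const_mul
      (-1 : ℂ) |>.const_add (b : ℂ)
    convert! this using 1
    rw [mul_pow, h1]
    simp
    field_simp
  have key := deriv_pow_eq_of_comp_eq_mul
    (J := fun z => (((√(p : ℝ) : ℝ) : ℂ) * z) ^ k)
    (analyticAt_comp_ofComplex (ModularFormClass.holo f) τ) hg hτ (by fun_prop) ?_ hn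
  · have hne : ((√(p : ℝ) : ℝ) : ℂ) * τ ≠ 0 := mul_ne_zero h0 hz
    rw [inv_pow, ← pow_mul] at key
    rw [pow_add, ← key, inv_mul_cancel₀ (pow_ne_zero _ hne)]
  · filter_upwards [eventually_im_pos τ] with z hz
    lift z to ℍ using hz
    have : (b : ℂ) + -1 / (p * (z : ℂ)) = ((b +ᵥ W p • z : ℍ) : ℂ) := by
      rw [coe_vadd, coe_W_smul]
    rw [this, ofComplex_apply, ofComplex_apply, hb, apply_W_smul]

lemma sqrt_two_mul_iDivSqrtTwo : ((√2 : ℝ) : ℂ) * iDivSqrtTwo = Complex.I := by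
  have h0 : ((√2 : ℝ) : ℂ) ≠ 0 := by simp
  change ((√2 : ℝ) : ℂ) * (Complex.I / ((√2 : ℝ) : ℂ)) = _
  field_simp

lemma ofReal_sqrt_two_sq : ((√2 : ℝ) : ℂ) ^ 2 = 2 := by
  rw [← Complex.ofReal_pow, Real.sq_sqrt zero_le_two]; simp

lemma coe_rhoTwo : (rhoTwo : ℂ) = (-1 + Complex.I) / 2 := by
  change Complex.exp (Complex.I * (3 * Real.pi / 4)) / ((√2 : ℝ) : ℂ) = _
  have h : Complex.I * (3 * Real.pi / 4) = ((Real.pi - Real.pi / 4 : ℝ) : ℂ) * Complex.I := by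
    push_cast; ring
  rw [h, Complex.exp_mul_I, ← Complex.ofReal_cos, ← Complex.ofReal_sin, Real.cos_pi_sub,
    Real.sin_pi_sub, Real.cos_pi_div_four, Real.sin_pi_div_four]
  have h0 : ((√2 : ℝ) : ℂ) ≠ 0 := by simp
  push_cast
  field_simp

lemma sqrt_two_mul_rhoTwo_sq : (((√2 : ℝ) : ℂ) * rhoTwo) ^ 2 = -Complex.I := by
  rw [mul_pow, ofReal_sqrt_two_sq, coe_rhoTwo]
  ring_nf
  rw [Complex.I_sq]
  ring

lemma two_dvd_of_ordAt_iDivSqrtTwo {m n : ℕ} {k : ℕ} (hk : k = 2 * m)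
    (f : ModularForm (Gamma0Star 2) (k : ℤ)) (hn : ordAt f iDivSqrtTwo = n) : 2 ∣ m + n := by
  subst hk
  have h := automorphy_pow_eq_one f (b := 0) (by simp) ?_ hn
  · rw [← mul_add, pow_mul] at h
    simp only [Nat.cast_ofNat] at h
    rw [sqrt_two_mul_iDivSqrtTwo, Complex.I_sq] at h
    rw [← even_iff_two_dvd]
    by_contra hodd
    rw [(Nat.not_even_iff_odd.mp hodd).neg_one_pow] at h
    norm_num at h
  · have hz := iDivSqrtTwo.ne_zero
    have h2 : (2 : ℂ) * (iDivSqrtTwo : ℂ) ^ 2 = -1 := by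
      rw [← ofReal_sqrt_two_sq, ← mul_pow, sqrt_two_mul_iDivSqrtTwo, Complex.I_sq]
    simp only [Complex.ofReal_zero, zero_add, Nat.cast_ofNat]
    rw [← h2]
    field_simp

lemma four_dvd_of_ordAt_rhoTwo {m n : ℕ} {k : ℕ} (hk : k = 2 * m)
    (f : ModularForm (Gamma0Star 2) (k : ℤ)) (hn : ordAt f rhoTwo = n) : 4 ∣ m + n := by
  subst hk
  have h := automorphy_pow_eq_one f (b := -1) (apply_vadd f) ?_ hn
  · rw [← mul_add, pow_mul] at h
    simp only [Nat.cast_ofNat] at h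
    rw [sqrt_two_mul_rhoTwo_sq] at h
    have h4 : (-Complex.I) ^ 4 = 1 := by rw [neg_pow, Complex.I_pow_four]; norm_num
    rw [← Nat.div_add_mod (m + n) 4, pow_add, pow_mul, h4, one_pow, one_mul] at h
    have hlt := Nat.mod_lt (m + n) (show 0 < 4 by norm_num)
    rw [Nat.dvd_iff_mod_eq_zero]
    generalize (m + n) % 4 = r at h hlt
    interval_cases r
    · rfl
    · simpa using congrArg Complex.re h
    · norm_num at h
    · simpa [pow_succ] using congrArg Complex.re h
  · have hz : (-1 + Complex.I) ≠ 0 := fun h => by simpa using congrArg Complex.im h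
    rw [coe_rhoTwo]
    push_cast
    field_simp
    ring_nf
    simp
    ring

/-! ### Taylor coefficients of `E_k` as sums over coprime pairs -/

/-- The sum over coprime `(c, d)` of `L ^ (-(k + n)) * conj L ^ n` with `L = c τ + d`. -/
noncomputable def coprimeSum (k n : ℕ) (τ : ℍ) : ℂ :=
  ∑' v : gammaSet 1 1 0,
    ((v.1 0 * (τ : ℂ) + v.1 1) ^ (k + n))⁻¹ * conj (v.1 0 * (τ : ℂ) + v.1 1) ^ n

lemma linear_smul (v : Fin 2 → ℤ) (γ : SL(2, ℤ)) (τ : ℍ) :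
    (v 0 * ((γ • τ : ℍ) : ℂ) + v 1) = (denom γ τ)⁻¹ *
      ((Matrix.vecMul v γ.1) 0 * (τ : ℂ) + (Matrix.vecMul v γ.1) 1) := by
  have := eisSummand_SL2_apply (-1) v γ τ
  simpa [eisSummand] using this

/-- Right multiplication by `γ` permutes the coprime pairs, and each `L` changes by the factor
`denom γ τ`. -/
lemma coprimeSum_smul (k n : ℕ) (γ : SL(2, ℤ)) (τ : ℍ) :
    coprimeSum k n (γ • τ) =
      denom γ τ ^ (k + n) * (conj (denom γ τ) ^ n)⁻¹ * coprimeSum k n τ := by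
  have h0 : Matrix.vecMul (0 : Fin 2 → ZMod 1) (γ.map (Int.castRingHom (ZMod 1))).1 = 0 :=
    Subsingleton.elim _ _
  simp only [coprimeSum, linear_smul]
  rw [← tsum_mul_left]
  let e : gammaSet 1 1 0 ≃ gammaSet 1 1 0 :=
    (gammaSetEquiv (0 : Fin 2 → ZMod 1) γ).trans (gammaSet_one_equiv 1 _ 0)
  rw [← e.tsum_eq (fun v : gammaSet 1 1 0 => _ * (((v.1 0 * (τ : ℂ) + v.1 1) ^ (k + n))⁻¹ *
    conj (v.1 0 * (τ : ℂ) + v.1 1) ^ n))]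
  refine tsum_congr fun v => ?_
  have he : (e v).1 = Matrix.vecMul v.1 γ.1 := rfl
  rw [he]
  simp only [mul_pow, map_mul, map_inv₀, mul_inv, inv_inv, inv_pow]
  ring

lemma linear_ne_zero_of_gammaSet (v : gammaSet 1 1 0) (τ : ℍ) :
    (v.1 0 * (τ : ℂ) + v.1 1) ≠ 0 := by
  have hv := (mem_gammaSet_one v.1).mp v.2
  have h := UpperHalfPlane.linear_ne_zero (cd := fun i => (v.1 i : ℝ)) τ fun h => by
    have h0 : v.1 0 = 0 := by simpa using congrFun h 0
    have h1 : v.1 1 = 0 := by simpa using congrFun h 1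
    rw [h0, h1] at hv
    exact not_isCoprime_zero_zero hv
  exact_mod_cast h

lemma E_apply {k : ℕ} (hk : 3 ≤ k) (z : ℍ) :
    E hk z = 1 / 2 * ∑' v : gammaSet 1 1 0, ((v.1 0 * (z : ℂ) + v.1 1) ^ k)⁻¹ := by
  have : E hk z = (1 / 2 : ℂ) * eisensteinSeries (0 : Fin 2 → ZMod 1) k z := rfl
  rw [this, eisensteinSeries]
  simp only [eisSummand, zpow_neg, zpow_natCast]

/-- The Taylor expansion of `E_k` in the Cayley coordinate `u` at `τ`. -/
lemma hasSum_E_cayley {k : ℕ} (hk : 3 ≤ k) {τ z : ℍ} {u : ℂ} (hu : ‖u‖ < 1)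
    (hz : (z : ℂ) * (1 - u) = τ - conj (τ : ℂ) * u) :
    HasSum (fun n : ℕ => ((n + (k - 1)).choose (k - 1) * (1 / 2 * coprimeSum k n τ)) * u ^ n)
      (((1 - u) ^ k)⁻¹ * E hk z) := by
  obtain ⟨j, rfl⟩ : ∃ j, k = j + 1 := ⟨k - 1, by omega⟩
  have hs : Summable fun v : gammaSet 1 1 0 =>
      ‖((v.1 0 * (τ : ℂ) + v.1 1) ^ (j + 1))⁻¹‖ := by
    have := (summable_norm_eisSummand (k := (j + 1 : ℕ)) (by exact_mod_cast hk) τ).subtype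
      (gammaSet 1 1 0)
    refine this.congr fun v => ?_
    simp only [Function.comp_apply, eisSummand, zpow_neg, zpow_natCast]
  have h := (hasSum_tsum_inv_sub_mul_pow
    (A := fun v : gammaSet 1 1 0 => v.1 0 * (τ : ℂ) + v.1 1)
    (B := fun v : gammaSet 1 1 0 => conj (v.1 0 * (τ : ℂ) + v.1 1))
    (fun v => linear_ne_zero_of_gammaSet v τ) (fun v => Complex.norm_conj _) hs hu).mul_left (1 / 2)
  convert! h using 1
  · ext n
    simp only [coprimeSum, Nat.add_sub_cancel]
    ring
  · rw [E_apply, mul_left_comm, ← tsum_mul_left]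
    congr 1
    refine tsum_congr fun v => ?_
    rw [← mul_inv, ← mul_pow]
    congr 2
    simp only [map_add, map_mul, map_intCast]
    -- This is `(1 - u)(cz + d) = L - conj(L) u`.
    linear_combination (v.1 0 : ℂ) * hz

/-! ### Nonvanishing of the coprime sums -/

lemma hasSum_int_inv_sq : HasSum (fun n : ℤ => ((n : ℝ) ^ 2)⁻¹) (Real.pi ^ 2 / 3) := by
  have h : HasSum (fun n : ℕ => (((n : ℤ) : ℝ) ^ 2)⁻¹) (Real.pi ^ 2 / 6) := by
    simpa using hasSum_zeta_two
  have h' := HasSum.of_nat_of_neg (f := fun n : ℤ => ((n : ℝ) ^ 2)⁻¹) h (by simpa using h)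
  convert! h' using 1
  simp
  ring

/-- The only coprime pairs on the axes are `(0, ±1)` and `(±1, 0)`, contributing `2 + 2e`; `r` is
the off-axis remainder, bounded by `C (∑ x⁻²)²`. -/
lemma tsum_coprime_ne_zero {a : ℤ → ℤ → ℂ} {C : ℝ} {e : ℂ} (h1 : a 0 1 = 1)
    (h2 : a 0 (-1) = 1) (h3 : a 1 0 = e) (h4 : a (-1) 0 = e)
    (hb : ∀ x y : ℤ, x ≠ 0 → y ≠ 0 → ‖a x y‖ ≤ C * (((x : ℝ) ^ 2)⁻¹ * ((y : ℝ) ^ 2)⁻¹))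
    (hlt : C * (Real.pi ^ 2 / 3) ^ 2 < ‖2 + 2 * e‖) :
    ∑' v : gammaSet 1 1 0, a (v.1 0) (v.1 1) ≠ 0 := by
  classical
  set b : ℤ × ℤ → ℂ := fun p => if IsCoprime p.1 p.2 then a p.1 p.2 else 0 with hbdef
  set r : ℤ × ℤ → ℂ := fun p => if p.1 = 0 ∨ p.2 = 0 then 0 else b p with hr
  have hC : 0 ≤ C := by simpa using (norm_nonneg _).trans (hb 1 1 one_ne_zero one_ne_zero)
  have hsum : HasSum (fun p : ℤ × ℤ => C * (((p.1 : ℝ) ^ 2)⁻¹ * ((p.2 : ℝ) ^ 2)⁻¹))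
      (C * (Real.pi ^ 2 / 3) ^ 2) := by
    rw [sq (Real.pi ^ 2 / 3)]
    exact (hasSum_int_inv_sq.mul hasSum_int_inv_sq (hasSum_int_inv_sq.summable.mul_of_nonneg
      hasSum_int_inv_sq.summable (fun _ => by positivity) fun _ => by positivity)).mul_left C
  have hrle : ∀ p, ‖r p‖ ≤ C * (((p.1 : ℝ) ^ 2)⁻¹ * ((p.2 : ℝ) ^ 2)⁻¹) := fun p => by
    simp only [hr, hbdef]
    split_ifs with h h'
    · simpa using by positivity
    · push Not at h
      exact hb _ _ h.1 h.2
    · simpa using by positivity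
  have hrs : Summable r := Summable.of_norm_bounded hsum.summable hrle
  have hrn : ‖∑' p, r p‖ ≤ C * (Real.pi ^ 2 / 3) ^ 2 := tsum_of_norm_bounded hsum hrle
  set s : Finset (ℤ × ℤ) := {(0, 1), (0, -1), (1, 0), (-1, 0)} with hs
  have hbr : HasSum (fun p => b p - r p) (∑ p ∈ s, (b p - r p)) := by
    refine hasSum_sum_of_ne_finset_zero fun p hp => ?_
    obtain ⟨x, y⟩ := p
    simp only [hr, hbdef]
    split_ifs with h h'
    · refine absurd ?_ hp
      rcases h' with h' | h' <;> subst h'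
      · rcases Int.isUnit_iff.mp (isCoprime_zero_left.mp h) with h5 | h5 <;> simp [hs, h5]
      · rcases Int.isUnit_iff.mp (isCoprime_zero_right.mp h) with h5 | h5 <;> simp [hs, h5]
    all_goals simp
  have hval : ∑ p ∈ s, (b p - r p) = 2 + 2 * e := by
    simp [hs, hr, hbdef, h1, h2, h3, h4, isCoprime_zero_left, isCoprime_zero_right]
    ring
  have htot : ∑' v : gammaSet 1 1 0, a (v.1 0) (v.1 1) = (2 + 2 * e) + ∑' p, r p := by
    have hb' : HasSum b ((2 + 2 * e) + ∑' p, r p) := by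
      simpa [hval] using hbr.add hrs.hasSum
    rw [← hb'.tsum_eq, ← (finTwoArrowEquiv ℤ).tsum_eq,
      tsum_subtype (gammaSet 1 1 0) (fun v => a (v 0) (v 1))]
    refine tsum_congr fun v => ?_
    simp only [Set.indicator_apply, mem_gammaSet_one]
    rfl
  rw [htot]
  intro h
  rw [eq_neg_of_add_eq_zero_left h, norm_neg] at hlt
  linarith

lemma coprimeSum_ne_zero {k n : ℕ} (hk : 4 ≤ k) (hk2 : Even k) {τ : ℍ} (hre : τ.re = 0)
    (him : 1 ≤ τ.im ^ 2) (h : 1 / (4 * τ.im ^ 2) * (Real.pi ^ 2 / 3) ^ 2 <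
      ‖2 + 2 * (((τ : ℂ) ^ (k + n))⁻¹ * conj (τ : ℂ) ^ n)‖) : coprimeSum k n τ ≠ 0 := by
  have hneg : ∀ w : ℂ, ((-w) ^ (k + n))⁻¹ * (-conj w) ^ n = (w ^ (k + n))⁻¹ * conj w ^ n := by
    intro w
    rw [neg_pow w, neg_pow (conj w), pow_add (-1 : ℂ), hk2.neg_one_pow, one_mul, mul_inv]
    rcases neg_one_pow_eq_or ℂ n with h | h <;> rw [h] <;> simp
  refine tsum_coprime_ne_zero
    (a := fun x y => ((x * (τ : ℂ) + y) ^ (k + n))⁻¹ * conj (x * (τ : ℂ) + y) ^ n)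
    (by simp) ?_ (by simp) ?_ ?_ h
  · simpa using hneg 1
  · simpa using hneg τ
  · intro x y hx hy
    set w : ℂ := x * (τ : ℂ) + y with hw
    have hx2 : (1 : ℝ) ≤ (x : ℝ) ^ 2 := by
      exact_mod_cast Int.one_le_abs hx |> (one_le_sq_iff_one_le_abs _).mpr
    have hy2 : (1 : ℝ) ≤ (y : ℝ) ^ 2 := by
      exact_mod_cast Int.one_le_abs hy |> (one_le_sq_iff_one_le_abs _).mpr
    have hn : ‖w‖ ^ 2 = (y : ℝ) ^ 2 + τ.im ^ 2 * (x : ℝ) ^ 2 := by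
      rw [← Complex.normSq_eq_norm_sq, Complex.normSq_apply]
      simp [hw, hre]
      ring
    have hone : 1 ≤ ‖w‖ := by
      rw [← one_le_sq_iff₀ (norm_nonneg _), hn]
      nlinarith
    have hw0 : ‖w‖ ≠ 0 := by linarith
    rw [norm_mul, norm_inv, norm_pow, norm_pow, Complex.norm_conj, pow_add, mul_inv,
      inv_mul_cancel_right₀ (pow_ne_zero _ hw0)]
    calc (‖w‖ ^ k)⁻¹ ≤ (‖w‖ ^ 4)⁻¹ := by gcongr
      _ ≤ (4 * τ.im ^ 2 * ((x : ℝ) ^ 2 * (y : ℝ) ^ 2))⁻¹ := by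
        have : (0 : ℝ) < τ.im ^ 2 := by linarith
        gcongr
        calc _ ≤ (‖w‖ ^ 2) ^ 2 := by
              rw [hn]
              -- AM-GM: `(A + B)² ≥ 4AB` separates the variables and produces the constant `1/(4 (Im
              -- τ)²)`.
              nlinarith [sq_nonneg ((y : ℝ) ^ 2 - τ.im ^ 2 * (x : ℝ) ^ 2)]
          _ = ‖w‖ ^ 4 := by ring
      _ = _ := by rw [mul_inv, mul_inv ((x : ℝ) ^ 2), one_div]

/-! ### Upper bounds for the Eisenstein series -/

lemma coe_natSMul (p : ℕ) [NeZero p] (z : ℍ) : (natSMul p z : ℂ) = p * z := rfl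

/-- If the `n`-th Taylor coefficient in the Cayley coordinate does not vanish, the order of
vanishing is at most `n`. -/
lemma ordAt_smul_eisensteinStar_le {p k n : ℕ} [NeZero p] (hk : 3 ≤ k) {a : ℂ} (ha : a ≠ 0) (τ : ℍ)
    (h : (((p : ℝ) ^ ((k : ℝ) / 2) : ℝ) : ℂ) * coprimeSum k n (natSMul p τ)
      + coprimeSum k n τ ≠ 0) :
    ordAt (a • eisensteinStar p hk : ModularForm (Gamma0Star p) (k : ℤ)) τ ≤ n := by
  set q : ℂ := (((p : ℝ) ^ ((k : ℝ) / 2) : ℝ) : ℂ) with hq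
  have hq1 : 1 / (q + 1) ≠ 0 := by
    have : (0 : ℝ) < (p : ℝ) ^ ((k : ℝ) / 2) + 1 := by positivity
    rw [hq]
    exact one_div_ne_zero (by exact_mod_cast this.ne')
  by_contra hlt
  push Not at hlt
  set f : ModularForm (Gamma0Star p) (k : ℤ) := a • eisensteinStar p hk with hf
  have hf_apply : ∀ z, f z = a * (1 / (q + 1) * (q * E hk (natSMul p z) + E hk z)) := fun z => rfl
  let χ : ℂ → ℂ := fun u => (τ - conj (τ : ℂ) * u) / (1 - u)
  have hχ0 : χ 0 = τ := by simp [χ]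
  have hχ : HasDerivAt χ (τ - conj (τ : ℂ)) 0 := by
    have h1 : HasDerivAt (fun u : ℂ => τ - conj (τ : ℂ) * u) (-conj (τ : ℂ)) 0 := by
      simpa using ((hasDerivAt_id (0 : ℂ)).const_mul (conj (τ : ℂ))).const_sub (τ : ℂ)
    have h2 : HasDerivAt (fun u : ℂ => 1 - u) (-1) 0 := (hasDerivAt_id (0 : ℂ)).const_sub 1
    convert! h1.div h2 (by simp) using 1
    simp
    ring
  have hχ' : deriv χ 0 ≠ 0 := by
    rw [hχ.deriv]
    intro h0
    have := congrArg Complex.im h0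
    simp at this
    linarith [τ.im_pos]
  have hχan : AnalyticAt ℂ χ 0 := by
    have : (1 : ℂ) - 0 ≠ 0 := by simp
    fun_prop (disch := simpa using this)
  have hfan := analyticAt_comp_ofComplex (ModularFormClass.holo f) τ
  set Φ : ℂ → ℂ := fun u => ((1 - u) ^ k)⁻¹ * f (ofComplex (χ u)) with hΦ
  have hcomp : AnalyticAt ℂ ((fun z : ℂ => f (ofComplex z)) ∘ χ) 0 :=
    AnalyticAt.comp (by rwa [hχ0]) hχan
  have hord : (n : ℕ∞) < analyticOrderAt Φ 0 := by
    have h1 : AnalyticAt ℂ (fun u : ℂ => ((1 - u) ^ k)⁻¹) 0 := by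
      fun_prop (disch := simp)
    have : Φ = (fun u : ℂ => ((1 - u) ^ k)⁻¹) * ((fun z : ℂ => f (ofComplex z)) ∘ χ) := rfl
    rw [this, analyticOrderAt_mul h1 hcomp, analyticOrderAt_comp_of_deriv_ne_zero hχan hχ', hχ0]
    exact lt_of_lt_of_le hlt le_add_self
  have hsum : ∀ᶠ u in 𝓝 (0 : ℂ), HasSum (fun j : ℕ =>
      (a * (1 / (q + 1)) * ((j + (k - 1)).choose (k - 1) * (1 / 2)) *
        (q * coprimeSum k j (natSMul p τ) + coprimeSum k j τ)) * u ^ j) (Φ u) := by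
    have him : ∀ᶠ u in 𝓝 (0 : ℂ), 0 < (χ u).im := by
      have : Tendsto χ (𝓝 0) (𝓝 (τ : ℂ)) := hχ0 ▸ hχan.continuousAt.tendsto
      exact this.eventually (eventually_im_pos τ)
    filter_upwards [him, Metric.ball_mem_nhds (0 : ℂ) one_pos] with u hu hu1
    replace hu1 : ‖u‖ < 1 := by simpa using hu1
    have hu2 : 1 - u ≠ 0 := by
      intro h0
      rw [← sub_eq_zero.mp h0] at hu1
      simp at hu1
    have hz : ((⟨χ u, hu⟩ : ℍ) : ℂ) * (1 - u) = τ - conj (τ : ℂ) * u := div_mul_cancel₀ _ hu2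
    have e1 := hasSum_E_cayley hk hu1 hz
    -- Real scaling respects conjugation, so `pz` has the same Cayley coordinate at `pτ` as `z` at
    -- `τ`.
    have e2 := hasSum_E_cayley hk (τ := natSMul p τ) (z := natSMul p ⟨χ u, hu⟩) hu1 (by
      rw [coe_natSMul, coe_natSMul, mul_assoc, hz]
      simp
      ring)
    convert! ((e2.mul_left q).add e1).mul_left (a * (1 / (q + 1))) using 1
    · ext j
      ring
    · simp only [hΦ]
      rw [ofComplex_apply_of_im_pos hu, hf_apply]
      ring
  have h0 := coeff_eq_zero_of_lt_analyticOrderAt hsum hord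
  have hch : ((n + (k - 1)).choose (k - 1) : ℂ) ≠ 0 := by
    exact_mod_cast (Nat.choose_pos (Nat.le_add_left _ _)).ne'
  exact mul_ne_zero (mul_ne_zero (mul_ne_zero ha hq1)
    (mul_ne_zero hch (by norm_num))) h h0

lemma coprimeSum_one_vadd (k n : ℕ) (τ : ℍ) :
    coprimeSum k n ((1 : ℝ) +ᵥ τ) = coprimeSum k n τ := by
  have h : denom (ModularGroup.T : GL (Fin 2) ℝ) τ = 1 := by simp [denom, ModularGroup.coe_T]
  rw [← modular_T_smul, coprimeSum_smul, h]
  simp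

/-- The factor `τ^(k+n) / conj(τ)^n` equals `√2^k ζ^(k+2n)`; its value `√2^k` matches the weight
`2^(k/2)` of the other term in the Fricke series, so the two add instead of cancelling. -/
lemma coprimeSum_S_smul (k n : ℕ) {τ : ℍ} {ζ : ℂ} (hζ : ζ * conj ζ = 1)
    (hτ : (τ : ℂ) = ((√2 : ℝ) : ℂ) * ζ) (h1 : ζ ^ (k + 2 * n) = 1) :
    coprimeSum k n (ModularGroup.S • τ) = ((√2 : ℝ) : ℂ) ^ k * coprimeSum k n τ := by
  have h0 : ((√2 : ℝ) : ℂ) ≠ 0 := by simp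
  have hc : conj ζ ≠ 0 := right_ne_zero_of_mul_eq_one hζ
  have hd : denom (ModularGroup.S : GL (Fin 2) ℝ) τ = τ := ModularGroup.denom_S _
  rw [coprimeSum_smul, hd, hτ]
  congr 1
  rw [map_mul, Complex.conj_ofReal, mul_pow, mul_pow, pow_add _ k n, ← div_eq_mul_inv,
    div_eq_iff (by positivity)]
  have h2 : ζ ^ (k + n) = conj ζ ^ n := by
    rw [← mul_one (conj ζ ^ n), ← h1, show k + 2 * n = (k + n) + n by ring, pow_add _ (k + n),
      mul_left_comm, ← mul_pow, mul_comm (conj ζ), hζ, one_pow, mul_one]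
  rw [h2]
  ring

lemma two_rpow_half (k : ℕ) : (2 : ℝ) ^ ((k : ℝ) / 2) = √2 ^ k := by
  rw [Real.sqrt_eq_rpow, ← Real.rpow_natCast, ← Real.rpow_mul zero_le_two]
  congr 1
  ring

lemma pi_sq_lt_ten : Real.pi ^ 2 < 10 := by
  nlinarith [Real.pi_lt_d2, Real.pi_pos]

lemma coprimeSum_I_ne_zero {k n : ℕ} (hk : 4 ≤ k) (hk2 : Even k) (h : 4 ∣ k + 2 * n) :
    coprimeSum k n UpperHalfPlane.I ≠ 0 := by
  have hI : Complex.I ^ (k + 2 * n) = 1 := by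
    obtain ⟨c, hc⟩ := h
    rw [hc, pow_mul, Complex.I_pow_four, one_pow]
  have he : (Complex.I ^ (k + n))⁻¹ * conj Complex.I ^ n = 1 := by
    rw [Complex.conj_I, ← Complex.inv_I, inv_pow, ← mul_inv, ← pow_add,
      show k + n + n = k + 2 * n by ring, hI, inv_one]
  refine coprimeSum_ne_zero hk hk2 (by simp) (by simp) ?_
  rw [UpperHalfPlane.coe_I, he, UpperHalfPlane.I_im]
  norm_num
  -- With `π² < 10` the remainder is below `100/36`, less than the main term `4`.
  nlinarith [pi_sq_lt_ten, sq_nonneg Real.pi]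

lemma coe_natSMul_iDivSqrtTwo :
    (natSMul 2 iDivSqrtTwo : ℂ) = ((√2 : ℝ) : ℂ) * Complex.I := by
  rw [coe_natSMul, ← sqrt_two_mul_iDivSqrtTwo, ← mul_assoc, ← sq, ofReal_sqrt_two_sq]
  rfl

lemma coprimeSum_natSMul_iDivSqrtTwo_ne_zero {k : ℕ} (n : ℕ) (hk : 4 ≤ k) (hk2 : Even k) :
    coprimeSum k n (natSMul 2 iDivSqrtTwo) ≠ 0 := by
  have hre : (natSMul 2 iDivSqrtTwo).re = 0 := by
    rw [← coe_re, coe_natSMul_iDivSqrtTwo]; simp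
  have him : (natSMul 2 iDivSqrtTwo).im ^ 2 = 2 := by
    rw [← coe_im, coe_natSMul_iDivSqrtTwo]; simp
  have hn : ‖(natSMul 2 iDivSqrtTwo : ℂ)‖ = √2 := by
    rw [coe_natSMul_iDivSqrtTwo]; simp
  refine coprimeSum_ne_zero hk hk2 hre (by rw [him]; norm_num) ?_
  rw [him]
  generalize (natSMul 2 iDivSqrtTwo : ℂ) = w at hn
  have h0 : √2 ^ n ≠ 0 := by positivity
  have he : ‖(w ^ (k + n))⁻¹ * conj w ^ n‖ ≤ 1 / 4 := by
    rw [norm_mul, norm_inv, norm_pow, norm_pow, Complex.norm_conj, hn, pow_add, mul_inv,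
      inv_mul_cancel_right₀ h0, one_div]
    have h4 : (4 : ℝ) = √2 ^ 4 := by
      rw [show (4 : ℕ) = 2 * 2 by norm_num, pow_mul, Real.sq_sqrt zero_le_two]; norm_num
    rw [h4]
    gcongr
    exact Real.one_le_sqrt.mpr one_le_two
  have h2 := norm_sub_norm_le (2 : ℂ) (-(2 * ((w ^ (k + n))⁻¹ * conj w ^ n)))
  rw [sub_neg_eq_add, norm_neg, norm_mul, Complex.norm_ofNat] at h2
  -- Here the main term is at least `2 - 2/4 = 3/2`, the remainder below `100/72`.
  have h3 : 1 / (4 * 2) * (Real.pi ^ 2 / 3) ^ 2 < (3 / 2 : ℝ) := by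
    nlinarith [pi_sq_lt_ten, sq_nonneg Real.pi]
  linarith

lemma ordAt_iDivSqrtTwo_le {k n : ℕ} (hk : 4 ≤ k) (hk2 : Even k) (h : 4 ∣ k + 2 * n) {a : ℂ}
    (ha : a ≠ 0) : ordAt (a • eisensteinStar 2 (show 3 ≤ k by omega) :
      ModularForm (Gamma0Star 2) (k : ℤ)) iDivSqrtTwo ≤ n := by
  refine ordAt_smul_eisensteinStar_le _ ha _ ?_
  have hI : Complex.I ^ (k + 2 * n) = 1 := by
    obtain ⟨c, hc⟩ := h
    rw [hc, pow_mul, Complex.I_pow_four, one_pow]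
  have hS : ModularGroup.S • natSMul 2 iDivSqrtTwo = iDivSqrtTwo := by
    ext
    rw [modular_S_smul]
    have h2 : (2 : ℂ) * (iDivSqrtTwo : ℂ) ^ 2 = -1 := by
      rw [← ofReal_sqrt_two_sq, ← mul_pow, sqrt_two_mul_iDivSqrtTwo, Complex.I_sq]
    change (-(natSMul 2 iDivSqrtTwo : ℂ))⁻¹ = _
    refine (eq_inv_of_mul_eq_one_left ?_).symm
    rw [coe_natSMul]
    push_cast
    linear_combination -h2
  have hT := coprimeSum_S_smul k n (by simp) coe_natSMul_iDivSqrtTwo hI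
  rw [hS] at hT
  rw [hT, Nat.cast_ofNat, two_rpow_half, Complex.ofReal_pow, ← two_mul]
  exact mul_ne_zero two_ne_zero
    (mul_ne_zero (by simp) (coprimeSum_natSMul_iDivSqrtTwo_ne_zero n hk hk2))

lemma ordAt_rhoTwo_le {k n : ℕ} (hk : 4 ≤ k) (hk2 : Even k) (h : 8 ∣ k + 2 * n) {a : ℂ}
    (ha : a ≠ 0) : ordAt (a • eisensteinStar 2 (show 3 ≤ k by omega) :
      ModularForm (Gamma0Star 2) (k : ℤ)) rhoTwo ≤ n := by
  refine ordAt_smul_eisensteinStar_le _ ha _ ?_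
  have h0 : ((√2 : ℝ) : ℂ) ≠ 0 := by simp
  set ζ : ℂ := (1 + Complex.I) / ((√2 : ℝ) : ℂ) with hζ
  have hζ2 : ζ ^ 2 = Complex.I := by
    rw [hζ, div_pow, ofReal_sqrt_two_sq]
    ring_nf
    rw [Complex.I_sq]
    ring
  have hζ1 : ζ ^ (k + 2 * n) = 1 := by
    obtain ⟨c, hc⟩ := h
    rw [hc, pow_mul, show 8 = 2 * 4 by norm_num, pow_mul, hζ2, Complex.I_pow_four, one_pow]
  have hζc : ζ * conj ζ = 1 := by
    rw [hζ, map_div₀, Complex.conj_ofReal, div_mul_div_comm, ← sq, ofReal_sqrt_two_sq]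
    simp only [map_add, map_one, Complex.conj_I]
    ring_nf
    rw [Complex.I_sq]
    ring
  have hτ : (((1 : ℝ) +ᵥ UpperHalfPlane.I : ℍ) : ℂ) = ((√2 : ℝ) : ℂ) * ζ := by
    rw [hζ, mul_div_cancel₀ _ h0, coe_vadd, UpperHalfPlane.coe_I, Complex.ofReal_one]
  have hS : ModularGroup.S • ((1 : ℝ) +ᵥ UpperHalfPlane.I : ℍ) = rhoTwo := by
    ext
    rw [modular_S_smul]
    change (-(((1 : ℝ) +ᵥ UpperHalfPlane.I : ℍ) : ℂ))⁻¹ = _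
    refine (eq_inv_of_mul_eq_one_left ?_).symm
    rw [coe_vadd, coe_I, coe_rhoTwo, Complex.ofReal_one]
    ring_nf
    rw [Complex.I_sq]
    ring
  -- `2ρ₂ = i - 1` is a translate of `i`, and `ρ₂ = S(1 + i)`, so both sums reduce to the one at
  -- `i`.
  have h2 : (1 : ℝ) +ᵥ natSMul 2 rhoTwo = UpperHalfPlane.I := by
    ext
    rw [coe_vadd, coe_natSMul, coe_rhoTwo, coe_I]
    push_cast
    ring
  have hT := coprimeSum_S_smul k n hζc hτ hζ1
  rw [hS, coprimeSum_one_vadd] at hT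
  rw [hT, ← coprimeSum_one_vadd k n (natSMul 2 rhoTwo), h2, Nat.cast_ofNat, two_rpow_half,
    Complex.ofReal_pow, ← two_mul]
  exact mul_ne_zero two_ne_zero (mul_ne_zero (by simp)
    (coprimeSum_I_ne_zero hk hk2 (dvd_trans (by norm_num) h)))

end Fricke

theorem mainTheorem7 (k : ℕ) (hk : 4 ≤ k) (hk_even : Even k) (s t : ℕ)
    (hs : s = 0 ∨ s = 1) (hsk : 2 * (s : ℤ) ≡ (k : ℤ) [ZMOD 4])
    (ht : t = 0 ∨ t = 1 ∨ t = 2 ∨ t = 3) (htk : -2 * (t : ℤ) ≡ (k : ℤ) [ZMOD 8]) :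
    (∀ f : ModularForm (Fricke.Gamma0Star 2) (k : ℤ),
      (s : ℕ∞) ≤ Fricke.ordAt f Fricke.iDivSqrtTwo ∧
      (t : ℕ∞) ≤ Fricke.ordAt f Fricke.rhoTwo) ∧
    (∀ f : ModularForm (Fricke.Gamma0Star 2) (k : ℤ),
      (∃ a : ℂ, a ≠ 0 ∧ f = a • Fricke.eisensteinStar 2 (le_trans (by norm_num) hk : 3 ≤ k)) →
      Fricke.ordAt f Fricke.iDivSqrtTwo = (s : ℕ∞) ∧
      Fricke.ordAt f Fricke.rhoTwo = (t : ℕ∞)) := by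
  obtain ⟨m, hm⟩ := hk_even.two_dvd
  have hs' := hsk.dvd
  have ht' := htk.dvd
  have lower : ∀ f : ModularForm (Fricke.Gamma0Star 2) (k : ℤ),
      (s : ℕ∞) ≤ Fricke.ordAt f Fricke.iDivSqrtTwo ∧
      (t : ℕ∞) ≤ Fricke.ordAt f Fricke.rhoTwo := by
    intro f
    constructor
    · cases hn : Fricke.ordAt f Fricke.iDivSqrtTwo with
      | top => exact le_top
      | coe n =>
        have := Fricke.two_dvd_of_ordAt_iDivSqrtTwo hm f hn
        -- The congruence gives `n ≡ s` mod 2, and `s` is the least natural number in its class.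
        exact_mod_cast (by omega : s ≤ n)
    · cases hn : Fricke.ordAt f Fricke.rhoTwo with
      | top => exact le_top
      | coe n =>
        have := Fricke.four_dvd_of_ordAt_rhoTwo hm f hn
        exact_mod_cast (by omega : t ≤ n)
  refine ⟨lower, ?_⟩
  rintro f ⟨a, ha, rfl⟩
  exact ⟨le_antisymm (Fricke.ordAt_iDivSqrtTwo_le hk hk_even (by omega) ha) (lower _).1,
    le_antisymm (Fricke.ordAt_rhoTwo_le hk hk_even (by omega) ha) (lower _).2⟩
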